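/- Let $k\in\mathbb{R}$ with $|k|\ge \tfrac12$, let $\sigma_1=\begin{pmatrix}0&1\\1&0\end{pmatrix}$, $\sigma_2=\begin{pmatrix}0&-\mathrm{i}\\ \mathrm{i}&0\end{pmatrix}$, and let $h_k$ be the self-adjoint Dirac operator $$h_k=-\mathrm{i}\,\sigma_1\partial_x+\sigma_2\frac{k}{x}\quad\text{in } L^2((0,\infty),\mathbb{C}^2)$$ (without further potentials, $A=V=0$), with domain $$\mathcal{D}(h_k)=\{\psi\in L^2((0,\infty),\mathbb{C}^2) : \psi \text{ is absolutely continuous on every compact subinterval of } (0,\infty),\ -\mathrm{i}\sigma_1\psi'+\sigma_2\tfrac{k}{x}\psi\in L^2((0,\infty),\mathbb{C}^2)\}.$$ For a measurable $M:(0,\infty)\to\mathbb{C}^{2\times2}$, the operator of multiplication by $M$ in $L^2((0,\infty),\mathbb{C}^2)$ has the domain $\mathcal{D}(M)=\{\psi\in L^2 : M\psi\in L^2\}$. It is called infinitesimally $h_k$-bounded if $\mathcal{D}(h_k)\subseteq\mathcal{D}(M)$ and for every $\varepsilon>0$ there is a constant $C\ge 0$ such that $$\|M\psi\|\le \varepsilon\|h_k\psi\|+C\|\psi\|\qquad\text{for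 all }\psi\in\mathcal{D}(h_k).$$ Then: 1. If $M\in L^p((0,\infty),\mathbb{C}^{2\times2})$ for some $p\in(2,\infty]$, then multiplication by $M$ is infinitesimally $h_k$-bounded. 2. If $|k|>\tfrac12$ and $M\in L^2((0,\infty),\mathbb{C}^{2\times2})$, then multiplication by $M$ is infinitesimally $h_k$-bounded. -/

import Mathlib

open MeasureTheory Set
open scoped ENNReal

namespace RadialDirac

noncomputable section

/-- The two-dimensional complex Euclidean space `ℂ²`. -/
abbrev Spinor : Type := EuclideanSpace ℂ (Fin 2)

/-- Lebesgue measure on the half-line `(0, ∞)`. -/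
abbrev halfLine : Measure ℝ := volume.restrict (Ioi (0 : ℝ))

/-- The Hilbert space `L²((0, ∞), ℂ²)`. -/
abbrev L2Spinor : Type := Lp Spinor 2 halfLine

/-- The Pauli matrix `σ₁`. -/
def sigma1 : Matrix (Fin 2) (Fin 2) ℂ := !![0, 1; 1, 0]

/-- The Pauli matrix `σ₂`. -/
def sigma2 : Matrix (Fin 2) (Fin 2) ℂ := !![0, -Complex.I; Complex.I, 0]

/-- A `2 × 2` matrix acting on a vector of `ℂ²`. -/
def act (m : Matrix (Fin 2) (Fin 2) ℂ) (v : Spinor) : Spinor := m.toEuclideanLin v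

/-- The differential expression `-i σ₁ u' + σ₂ (k / x) u`. -/
def diracExpr (k : ℝ) (u : ℝ → Spinor) (x : ℝ) : Spinor :=
  act sigma1 (-Complex.I • deriv u x) + act sigma2 (((k / x : ℝ) : ℂ) • u x)

/-- `u` is absolutely continuous on every compact subinterval of `(0, ∞)`. -/
def LocallyAC (u : ℝ → Spinor) : Prop :=
  ∀ a b : ℝ, 0 < a → a ≤ b → AbsolutelyContinuousOnInterval u a b

/-- `u` is an absolutely continuous representative of `ψ ∈ L²` to which the differential
expression can be applied inside `L²`. -/
structure IsRegularRep (k : ℝ) (ψ : L2Spinor) (u : ℝ → Spinor) : Prop where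
  ae_eq : ψ =ᵐ[halfLine] u
  locallyAC : LocallyAC u
  memLp : MemLp (diracExpr k u) 2 halfLine

theorem LocallyAC.continuousOn {u : ℝ → Spinor} (hu : LocallyAC u) :
    ContinuousOn u (Ioi 0) := by
  intro x hx
  have hx' : (0 : ℝ) < x := hx
  have h := (hu (x / 2) (2 * x) (by linarith) (by linarith)).continuousOn
  rw [uIcc_of_le (by linarith)] at h
  exact (h.continuousAt (Icc_mem_nhds (by linarith) (by linarith))).continuousWithinAt

theorem LocallyAC.ae_differentiableAt {u : ℝ → Spinor} (hu : LocallyAC u) :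
    ∀ᵐ x ∂halfLine, DifferentiableAt ℝ u x := by
  have h : ∀ n : ℕ, ∀ᵐ x : ℝ, x ∈ uIcc (1 / ((n : ℝ) + 1)) ((n : ℝ) + 1) →
      DifferentiableAt ℝ u x := fun n => by
    refine (hu _ _ (by positivity) ?_).boundedVariationOn.ae_differentiableAt_of_mem_uIcc
    rw [div_le_iff₀ (by positivity)]
    nlinarith [(Nat.cast_nonneg n : (0 : ℝ) ≤ n)]
  rw [ae_restrict_iff' measurableSet_Ioi]
  filter_upwards [ae_all_iff.2 h] with x hx hx0
  have hx0' : (0 : ℝ) < x := hx0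
  obtain ⟨n, hn⟩ := exists_nat_gt (max x (1 / x))
  have h1 : x < n := lt_of_le_of_lt (le_max_left _ _) hn
  have h2 : 1 / x < n := lt_of_le_of_lt (le_max_right _ _) hn
  refine hx n (mem_uIcc.2 (Or.inl ⟨?_, by linarith⟩))
  rw [div_le_iff₀ (by positivity)]
  rw [div_lt_iff₀ hx0'] at h2
  nlinarith

/-- The differential expression does not depend on the representative. -/
theorem IsRegularRep.diracExpr_eq {k : ℝ} {ψ : L2Spinor} {u v : ℝ → Spinor}
    (hu : IsRegularRep k ψ u) (hv : IsRegularRep k ψ v) :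
    diracExpr k u =ᵐ[halfLine] diracExpr k v := by
  have h : EqOn u v (Ioi 0) :=
    Measure.eqOn_open_of_ae_eq (hu.ae_eq.symm.trans hv.ae_eq) isOpen_Ioi
      hu.locallyAC.continuousOn hv.locallyAC.continuousOn
  refine (ae_restrict_iff' measurableSet_Ioi).2 (Filter.Eventually.of_forall fun x hx => ?_)
  have hd : deriv u x = deriv v x :=
    (Filter.eventuallyEq_of_mem (isOpen_Ioi.mem_nhds hx) h).deriv_eq
  simp only [diracExpr, hd, h hx]

theorem diracExpr_add (k : ℝ) {u v : ℝ → Spinor} {x : ℝ} (hu : DifferentiableAt ℝ u x)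
    (hv : DifferentiableAt ℝ v x) :
    diracExpr k (u + v) x = diracExpr k u x + diracExpr k v x := by
  simp only [diracExpr, act, deriv_add hu hv, Pi.add_apply, smul_add, map_add]
  abel

theorem diracExpr_smul (k : ℝ) (c : ℂ) {u : ℝ → Spinor} {x : ℝ}
    (hu : DifferentiableAt ℝ u x) :
    diracExpr k (c • u) x = c • diracExpr k u x := by
  have h : deriv (c • u) x = c • deriv u x := deriv_const_smul c hu
  simp only [diracExpr, act, h, Pi.smul_apply, map_smul, smul_add]
  rw [smul_comm c (-Complex.I), smul_comm c ((k / x : ℝ) : ℂ)]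

theorem IsRegularRep.ae_add {k : ℝ} {ψ φ : L2Spinor} {u v : ℝ → Spinor}
    (hu : IsRegularRep k ψ u) (hv : IsRegularRep k φ v) :
    diracExpr k (u + v) =ᵐ[halfLine] diracExpr k u + diracExpr k v := by
  filter_upwards [hu.locallyAC.ae_differentiableAt, hv.locallyAC.ae_differentiableAt]
    with x h1 h2 using diracExpr_add k h1 h2

theorem IsRegularRep.ae_smul {k : ℝ} {ψ : L2Spinor} {u : ℝ → Spinor}
    (hu : IsRegularRep k ψ u) (c : ℂ) :
    diracExpr k (c • u) =ᵐ[halfLine] c • diracExpr k u := by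
  filter_upwards [hu.locallyAC.ae_differentiableAt] with x h1 using diracExpr_smul k c h1

theorem IsRegularRep.add {k : ℝ} {ψ φ : L2Spinor} {u v : ℝ → Spinor}
    (hu : IsRegularRep k ψ u) (hv : IsRegularRep k φ v) :
    IsRegularRep k (ψ + φ) (u + v) where
  ae_eq := (Lp.coeFn_add ψ φ).trans (hu.ae_eq.add hv.ae_eq)
  locallyAC := fun a b ha hab => (hu.locallyAC a b ha hab).add (hv.locallyAC a b ha hab)
  memLp := (memLp_congr_ae (hu.ae_add hv)).2 (hu.memLp.add hv.memLp)

theorem IsRegularRep.smul {k : ℝ} {ψ : L2Spinor} {u : ℝ → Spinor}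
    (hu : IsRegularRep k ψ u) (c : ℂ) : IsRegularRep k (c • ψ) (c • u) where
  ae_eq := (Lp.coeFn_smul c ψ).trans (hu.ae_eq.const_smul c)
  locallyAC := fun a b ha hab => (hu.locallyAC a b ha hab).const_smul c
  memLp := (memLp_congr_ae (hu.ae_smul c)).2 (hu.memLp.const_smul c)

theorem isRegularRep_zero (k : ℝ) : IsRegularRep k 0 0 where
  ae_eq := Lp.coeFn_zero _ _ _
  locallyAC := fun a b _ _ =>
    (LipschitzWith.const (0 : Spinor)).lipschitzOnWith.absolutelyContinuousOnInterval
  memLp := by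
    have h : diracExpr k 0 = 0 := by
      funext x
      simp [diracExpr, act]
    rw [h]
    exact MemLp.zero

/-- The maximal domain: all `ψ ∈ L²((0, ∞), ℂ²)` that are (locally) absolutely continuous and
satisfy `-i σ₁ ψ' + σ₂ (k / x) ψ ∈ L²((0, ∞), ℂ²)`. -/
def diracDomain (k : ℝ) : Submodule ℂ L2Spinor where
  carrier := {ψ | ∃ u, IsRegularRep k ψ u}
  add_mem' := by
    rintro ψ φ ⟨u, hu⟩ ⟨v, hv⟩
    exact ⟨u + v, hu.add hv⟩
  zero_mem' := ⟨0, isRegularRep_zero k⟩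
  smul_mem' := by
    rintro c ψ ⟨u, hu⟩
    exact ⟨c • u, hu.smul c⟩

/-- The operator `h_k = -i σ₁ ∂ₓ + σ₂ k / x` in `L²((0, ∞), ℂ²)` on its maximal domain. For
`|k| ≥ 1/2` (limit point case at `0` and at `∞`) this is the self-adjoint operator `h_k`, i.e. the
closure of the restriction to compactly supported functions. -/
def diracOp (k : ℝ) : L2Spinor →ₗ.[ℂ] L2Spinor where
  domain := diracDomain k
  toFun :=
    { toFun := fun ψ => (Classical.choose_spec ψ.2).memLp.toLp _
      map_add' := fun ψ φ => by
        rw [← MemLp.toLp_add, MemLp.toLp_eq_toLp_iff]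
        have hψ := Classical.choose_spec ψ.2
        have hφ := Classical.choose_spec φ.2
        exact ((Classical.choose_spec (ψ + φ).2).diracExpr_eq (hψ.add hφ)).trans (hψ.ae_add hφ)
      map_smul' := fun c ψ => by
        rw [RingHom.id_apply, ← MemLp.toLp_const_smul, MemLp.toLp_eq_toLp_iff]
        have hψ := Classical.choose_spec ψ.2
        exact ((Classical.choose_spec (c • ψ).2).diracExpr_eq (hψ.smul c)).trans (hψ.ae_smul c) }

/-- `h_k ψ` is given by the differential expression applied to any absolutely continuous
representative of `ψ`. -/
theorem diracOp_ae_eq {k : ℝ} {u : ℝ → Spinor} (ψ : (diracOp k).domain)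
    (hu : IsRegularRep k (ψ : L2Spinor) u) :
    diracOp k ψ =ᵐ[halfLine] diracExpr k u := by
  have h := Classical.choose_spec ψ.2
  exact (MemLp.coeFn_toLp h.memLp).trans (h.diracExpr_eq hu)

/-- The operator of multiplication by the matrix-valued function `M` in `L²((0, ∞), ℂ²)`, on its
maximal domain `{ψ ∈ L² | M ψ ∈ L²}`. -/
def mulOp (M : ℝ → Matrix (Fin 2) (Fin 2) ℂ) : L2Spinor →ₗ.[ℂ] L2Spinor where
  domain :=
    { carrier := {ψ | MemLp (fun x => act (M x) (ψ x)) 2 halfLine}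
      add_mem' := by
        intro ψ φ hψ hφ
        refine (memLp_congr_ae ?_).2 (MemLp.add hψ hφ)
        filter_upwards [Lp.coeFn_add ψ φ] with x hx
        exact (congrArg (act (M x)) hx).trans (map_add (M x).toEuclideanLin _ _)
      zero_mem' := by
        refine (memLp_congr_ae ?_).2 (MemLp.zero (ε := Spinor) (p := 2) (μ := halfLine))
        filter_upwards [Lp.coeFn_zero Spinor 2 halfLine] with x hx
        exact (congrArg (act (M x)) hx).trans (map_zero (M x).toEuclideanLin)
      smul_mem' := by
        intro c ψ hψ
        refine (memLp_congr_ae ?_).2 (MemLp.const_smul hψ c)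
        filter_upwards [Lp.coeFn_smul c ψ] with x hx
        exact (congrArg (act (M x)) hx).trans (map_smul (M x).toEuclideanLin _ _) }
  toFun :=
    { toFun := fun ψ => MemLp.toLp (fun x => act (M x) ((ψ : L2Spinor) x)) ψ.2
      map_add' := fun ψ φ => by
        rw [← MemLp.toLp_add, MemLp.toLp_eq_toLp_iff]
        filter_upwards [Lp.coeFn_add (ψ : L2Spinor) φ] with x hx
        exact (congrArg (act (M x)) hx).trans (map_add (M x).toEuclideanLin _ _)
      map_smul' := fun c ψ => by
        rw [RingHom.id_apply, ← MemLp.toLp_const_smul, MemLp.toLp_eq_toLp_iff]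
        filter_upwards [Lp.coeFn_smul c (ψ : L2Spinor)] with x hx
        exact (congrArg (act (M x)) hx).trans (map_smul (M x).toEuclideanLin _ _) }

/-- `T` is infinitesimally `S`-bounded: `D(S) ⊆ D(T)` and for every `ε > 0` there is `C ≥ 0` with
`‖T ψ‖ ≤ ε ‖S ψ‖ + C ‖ψ‖` for all `ψ ∈ D(S)`. -/
def IsInfinitesimallyBounded {H : Type*} [NormedAddCommGroup H] [Module ℂ H]
    (T S : H →ₗ.[ℂ] H) : Prop :=
  ∃ hdom : S.domain ≤ T.domain, ∀ ε : ℝ, 0 < ε → ∃ C : ℝ, 0 ≤ C ∧ ∀ ψ : S.domain,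
    ‖T ⟨ψ, hdom ψ.2⟩‖ ≤ ε * ‖S ψ‖ + C * ‖(ψ : H)‖

end

end RadialDirac

namespace RadialDirac

/-! The heart of the matter is that every `ψ` in the domain of `h_k` is bounded, with `‖ψ‖_∞ ≤ 2
‖h_k ψ‖ + 4 ‖ψ‖` (`IsRegularRep.norm_le`). Since `σ₁` and `σ₂` are off-diagonal, `h_k` decouples
into scalar expressions `v' + (c / x) v` with `c = ±k`, and `sq_le_integral_of_half_le_abs` bounds
`v` in terms of the `L²` norms. For `c ≤ 0` the singular term has a good sign in `(-v²)'`; for `c ≥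
1/2` it has one in `(x v²)'`, and square integrability at `0` excludes the singular solution
`x^(-c)`.

For `p ≥ 2` the entries of `M` are dominated by `n + R` with `‖n‖₂ ≤ δ` and `R` constant. Hence `‖M
ψ‖ ≤ δ ‖ψ‖_∞ + R ‖ψ‖`, and `δ` is arbitrary. Both claims are instances of the case `p ≥ 2`, `|k| ≥
1/2`. -/

/-- An absolutely continuous function grows at most by the integral of a bound for its
derivative. -/
theorem sub_le_integral_of_ae_deriv_le {F G : ℝ → ℝ} {a b : ℝ} (hab : a ≤ b)
    (hF : AbsolutelyContinuousOnInterval F a b) (hG : IntegrableOn G (Icc a b))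
    (h : ∀ᵐ x ∂volume.restrict (Icc a b), deriv F x ≤ G x) :
    F b - F a ≤ ∫ x in Icc a b, G x := by
  rw [← hF.integral_deriv_eq_sub, integral_Icc_eq_integral_Ioc,
    ← intervalIntegral.integral_of_le hab]
  refine intervalIntegral.integral_mono_ae_restrict hab hF.intervalIntegrable_deriv ?_ h
  exact (intervalIntegrable_iff_integrableOn_Icc_of_le hab).2 hG

theorem ae_restrict_Icc_of_ae_halfLine {P : ℝ → Prop} (h : ∀ᵐ x ∂halfLine, P x) {a b : ℝ}
    (ha : 0 < a) : ∀ᵐ x ∂volume.restrict (Icc a b), P x :=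
  ae_restrict_of_ae_restrict_of_subset (fun _ hx => lt_of_lt_of_le ha hx.1) h

/-! ### Pointwise bounds for the scalar equation `v' + (c / x) v = g` -/

section Scalar

variable {c : ℝ} {v N G : ℝ → ℝ}

/-- With `g = v' + (c / t) v`, one has `(-v²)' = -2 v g + 2 (c / t) v²`. The last term is
nonpositive and the first is at most `N² + G²`; integrate from `x` to `y`. -/
theorem sq_le_sq_add_integral_of_nonpos (hc : c ≤ 0)
    (hv : ∀ a b : ℝ, 0 < a → a ≤ b → AbsolutelyContinuousOnInterval v a b)
    (hvN : ∀ᵐ x ∂halfLine, |v x| ≤ N x)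
    (hdiff : ∀ᵐ x ∂halfLine, DifferentiableAt ℝ v x)
    (hG : ∀ᵐ x ∂halfLine, |deriv v x + c / x * v x| ≤ G x)
    (hI : Integrable (fun x => N x ^ 2 + G x ^ 2) halfLine)
    {x y : ℝ} (hx : 0 < x) (hxy : x ≤ y) :
    v x ^ 2 ≤ v y ^ 2 + ∫ t, N t ^ 2 + G t ^ 2 ∂halfLine := by
  have hsub : Icc x y ⊆ Ioi 0 := fun t ht => lt_of_lt_of_le hx ht.1
  have hAC := ((hv x y hx hxy).fun_mul (hv x y hx hxy)).fun_neg
  have key := sub_le_integral_of_ae_deriv_le hxy hAC (hI.mono_measure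
    (Measure.restrict_mono hsub le_rfl)) ?_
  · have hmono : ∫ t in Icc x y, N t ^ 2 + G t ^ 2 ≤ ∫ t, N t ^ 2 + G t ^ 2 ∂halfLine :=
      setIntegral_mono_set hI (Filter.Eventually.of_forall fun t => by positivity)
        hsub.eventuallyLE
    nlinarith
  · filter_upwards [ae_restrict_Icc_of_ae_halfLine hvN hx,
      ae_restrict_Icc_of_ae_halfLine hdiff hx, ae_restrict_Icc_of_ae_halfLine hG hx,
      ae_restrict_mem measurableSet_Icc] with t h1 h2 h3 h4
    rw [(h2.hasDerivAt.fun_mul h2.hasDerivAt).fun_neg.deriv]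
    have ht : 0 < t := hsub h4
    have hct : c / t * v t * v t ≤ 0 := by
      have : c / t ≤ 0 := div_nonpos_of_nonpos_of_nonneg hc ht.le
      nlinarith [mul_self_nonneg (v t)]
    have h5 : -(v t * (deriv v t + c / t * v t)) ≤ N t * G t := by
      refine (neg_le_abs _).trans ?_
      rw [abs_mul]
      exact mul_le_mul h1 h3 (abs_nonneg _) ((abs_nonneg _).trans h1)
    nlinarith [sq_nonneg (N t - G t)]

/-- With `g = v' + (c / t) v`, one has `(t v²)' = (1 - 2 c) v² + 2 t v g`. The first term is
nonpositive exactly because `c ≥ 1/2`, and the second is at most `x (N² + G²)` for `t ≤ x`. -/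
theorem mul_sq_le_mul_sq_add_integral_of_half_le (hc : 1 / 2 ≤ c)
    (hv : ∀ a b : ℝ, 0 < a → a ≤ b → AbsolutelyContinuousOnInterval v a b)
    (hvN : ∀ᵐ x ∂halfLine, |v x| ≤ N x)
    (hdiff : ∀ᵐ x ∂halfLine, DifferentiableAt ℝ v x)
    (hG : ∀ᵐ x ∂halfLine, |deriv v x + c / x * v x| ≤ G x)
    (hI : Integrable (fun x => N x ^ 2 + G x ^ 2) halfLine)
    {x y : ℝ} (hy : 0 < y) (hyx : y ≤ x) :
    x * v x ^ 2 ≤ y * v y ^ 2 + x * ∫ t, N t ^ 2 + G t ^ 2 ∂halfLine := by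
  have hsub : Icc y x ⊆ Ioi 0 := fun t ht => lt_of_lt_of_le hy ht.1
  have hid : AbsolutelyContinuousOnInterval (fun t : ℝ => t) y x :=
    LipschitzWith.id.lipschitzOnWith.absolutelyContinuousOnInterval
  have hAC := hid.fun_mul ((hv y x hy hyx).fun_mul (hv y x hy hyx))
  have key := sub_le_integral_of_ae_deriv_le (G := fun t => x * (N t ^ 2 + G t ^ 2)) hyx hAC
    ((hI.mono_measure (Measure.restrict_mono hsub le_rfl)).const_mul x) ?_
  · have hmono : ∫ t in Icc y x, N t ^ 2 + G t ^ 2 ≤ ∫ t, N t ^ 2 + G t ^ 2 ∂halfLine :=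
      setIntegral_mono_set hI (Filter.Eventually.of_forall fun t => by positivity)
        hsub.eventuallyLE
    rw [integral_const_mul] at key
    have := mul_le_mul_of_nonneg_left hmono (hy.le.trans hyx)
    nlinarith
  · filter_upwards [ae_restrict_Icc_of_ae_halfLine hvN hy,
      ae_restrict_Icc_of_ae_halfLine hdiff hy, ae_restrict_Icc_of_ae_halfLine hG hy,
      ae_restrict_mem measurableSet_Icc] with t h1 h2 h3 h4
    rw [((hasDerivAt_id' t).fun_mul (h2.hasDerivAt.fun_mul h2.hasDerivAt)).deriv]
    have ht : 0 < t := hsub h4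
    have h5 : v t * (deriv v t + c / t * v t) ≤ N t * G t := by
      refine (le_abs_self _).trans ?_
      rw [abs_mul]
      exact mul_le_mul h1 h3 (abs_nonneg _) ((abs_nonneg _).trans h1)
    have h6 : 2 * (v t * (deriv v t + c / t * v t)) ≤ N t ^ 2 + G t ^ 2 := by
      nlinarith [sq_nonneg (N t - G t)]
    have h7 : t * (2 * (v t * (deriv v t + c / t * v t))) =
        2 * t * v t * deriv v t + 2 * c * v t ^ 2 := by
      field_simp
    have h8 : t * (2 * (v t * (deriv v t + c / t * v t))) ≤ x * (N t ^ 2 + G t ^ 2) :=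
      (mul_le_mul_of_nonneg_left h6 ht.le).trans
        (mul_le_mul_of_nonneg_right h4.2 (by positivity))
    nlinarith [sq_nonneg (v t)]

/-- Pointwise bound for solutions of `|v' + (c / x) v| ≤ G` with `|c| ≥ 1/2` that are square
integrable. -/
theorem sq_le_integral_of_half_le_abs (hc : 1 / 2 ≤ |c|)
    (hv : ∀ a b : ℝ, 0 < a → a ≤ b → AbsolutelyContinuousOnInterval v a b)
    (hvN : ∀ᵐ x ∂halfLine, |v x| ≤ N x)
    (hdiff : ∀ᵐ x ∂halfLine, DifferentiableAt ℝ v x)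
    (hG : ∀ᵐ x ∂halfLine, |deriv v x + c / x * v x| ≤ G x)
    (hN2 : Integrable (fun x => N x ^ 2) halfLine)
    (hG2 : Integrable (fun x => G x ^ 2) halfLine) {x : ℝ} (hx : 0 < x) :
    v x ^ 2 ≤ 2 * ∫ t, N t ^ 2 ∂halfLine + ∫ t, G t ^ 2 ∂halfLine := by
  have hI : Integrable (fun x => N x ^ 2 + G x ^ 2) halfLine := hN2.add hG2
  have hsplit : ∫ t, N t ^ 2 + G t ^ 2 ∂halfLine =
      ∫ t, N t ^ 2 ∂halfLine + ∫ t, G t ^ 2 ∂halfLine := integral_add hN2 hG2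
  have hN0 : 0 ≤ ∫ t, N t ^ 2 ∂halfLine := integral_nonneg fun t => by positivity
  have hsq : ∀ᵐ t ∂halfLine, v t ^ 2 ≤ N t ^ 2 := by
    filter_upwards [hvN] with t ht
    exact sq_le_sq' (by linarith [neg_abs_le (v t)]) ((le_abs_self _).trans ht)
  rcases le_total c 0 with h0 | h0
  -- Averaging over `y` in an interval of length one replaces `v y ^ 2` by the integral of `N²`.
  · have hsub : Icc x (x + 1) ⊆ Ioi 0 := fun t ht => lt_of_lt_of_le hx ht.1
    have hbound : ∀ᵐ t ∂volume.restrict (Icc x (x + 1)),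
        v x ^ 2 - ∫ t, N t ^ 2 + G t ^ 2 ∂halfLine ≤ N t ^ 2 := by
      filter_upwards [ae_restrict_Icc_of_ae_halfLine hsq hx, ae_restrict_mem measurableSet_Icc]
        with t h1 h2
      linarith [sq_le_sq_add_integral_of_nonpos h0 hv hvN hdiff hG hI hx h2.1]
    have hmono := integral_mono_ae (integrable_const _)
      (hN2.mono_measure (Measure.restrict_mono hsub le_rfl)) hbound
    rw [integral_const] at hmono
    have hmono' : ∫ t in Icc x (x + 1), N t ^ 2 ≤ ∫ t, N t ^ 2 ∂halfLine :=
      setIntegral_mono_set hN2 (Filter.Eventually.of_forall fun t => by positivity)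
        hsub.eventuallyLE
    simp at hmono
    linarith
  · rw [abs_of_nonneg h0] at hc
    by_contra! hlt
    set B := ∫ t, N t ^ 2 + G t ^ 2 ∂halfLine with hB
    -- If `v x ^ 2 > B`, then `t v(t)²` stays above this positive constant on `(0, x]`, so `1 / t`
    -- is dominated there by a multiple of the integrable `N²`, which is absurd.
    have hδ : 0 < x * (v x ^ 2 - B) := mul_pos hx (by linarith)
    have hinv : IntegrableOn (fun t : ℝ => t⁻¹) (Ioc 0 x) := by
      have hN' : IntegrableOn (fun t => (x * (v x ^ 2 - B))⁻¹ * N t ^ 2) (Ioc 0 x) :=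
        (hN2.mono_measure (Measure.restrict_mono Ioc_subset_Ioi_self le_rfl)).const_mul _
      refine hN'.mono' measurable_inv.aestronglyMeasurable ?_
      filter_upwards [ae_restrict_of_ae_restrict_of_subset Ioc_subset_Ioi_self hsq,
        ae_restrict_mem measurableSet_Ioc] with t h1 h2
      have h3 := mul_sq_le_mul_sq_add_integral_of_half_le hc hv hvN hdiff hG hI h2.1 h2.2
      rw [Real.norm_of_nonneg (inv_nonneg.2 h2.1.le), inv_mul_eq_div, le_div_iff₀ hδ,
        inv_mul_le_iff₀ h2.1]
      have := mul_le_mul_of_nonneg_left h1 h2.1.le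
      linarith
    have := (intervalIntegrable_iff_integrableOn_Ioc_of_le hx.le).2 hinv
    rw [intervalIntegrable_inv_iff] at this
    rcases this with h | h
    · exact hx.ne h
    · exact h left_mem_uIcc

end Scalar

/-! ### Boundedness of spinors in the domain of `h_k` -/

theorem _root_.AbsolutelyContinuousOnInterval.clm_comp {E F : Type*} [NormedAddCommGroup E]
    [NormedSpace ℝ E] [NormedAddCommGroup F] [NormedSpace ℝ F] {u : ℝ → E} {a b : ℝ}
    (hu : AbsolutelyContinuousOnInterval u a b) (ℓ : E →L[ℝ] F) :
    AbsolutelyContinuousOnInterval (fun x => ℓ (u x)) a b := by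
  refine squeeze_zero (fun t => Finset.sum_nonneg fun i _ => dist_nonneg) (fun t => ?_)
    (by simpa using Filter.Tendsto.const_mul ‖ℓ‖ hu)
  rw [Finset.mul_sum]
  refine Finset.sum_le_sum fun i _ => ?_
  rw [dist_eq_norm, dist_eq_norm, ← map_sub]
  exact ℓ.le_opNorm _

theorem integral_norm_sq_eq_norm_sq (ψ : L2Spinor) :
    ∫ x, ‖ψ x‖ ^ 2 ∂halfLine = ‖ψ‖ ^ 2 := by
  have h := inner_self_eq_norm_sq_to_K (𝕜 := ℂ) ψ
  rw [L2.inner_def] at h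
  simp only [inner_self_eq_norm_sq_to_K] at h
  have h2 : ∫ x, (((‖ψ x‖ ^ 2 : ℝ) : ℂ)) ∂halfLine = ((‖ψ‖ ^ 2 : ℝ) : ℂ) := by
    simpa using h
  exact Complex.ofReal_injective (integral_complex_ofReal.symm.trans h2)

theorem integrable_norm_sq (ψ : L2Spinor) : Integrable (fun x => ‖ψ x‖ ^ 2) halfLine :=
  (memLp_two_iff_integrable_sq_norm (Lp.aestronglyMeasurable ψ)).1 (Lp.memLp ψ)

theorem diracExpr_apply_zero (k : ℝ) (u : ℝ → Spinor) (x : ℝ) :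
    diracExpr k u x 0 = -Complex.I * (deriv u x 1 + (k / x : ℝ) * u x 1) := by
  simp [diracExpr, act, sigma1, sigma2, Matrix.toLpLin_apply, dotProduct]
  ring

theorem diracExpr_apply_one (k : ℝ) (u : ℝ → Spinor) (x : ℝ) :
    diracExpr k u x 1 = -Complex.I * (deriv u x 0 + (-k / x : ℝ) * u x 0) := by
  simp [diracExpr, act, sigma1, sigma2, Matrix.toLpLin_apply, dotProduct]
  ring

/-- A coordinate of a spinor as a real linear map. -/
noncomputable def coord (i : Fin 2) : Spinor →L[ℝ] ℂ :=
  (EuclideanSpace.proj i : Spinor →L[ℂ] ℂ).restrictScalars ℝ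

/-- Component `i` of `u` is governed by the other component of the Dirac expression; `c` is `-k` for
`i = 0` and `k` for `i = 1`. -/
theorem norm_deriv_add_le_norm_diracExpr (k : ℝ) (u : ℝ → Spinor) (i : Fin 2) :
    ∃ c : ℝ, |c| = |k| ∧
      ∀ x, ‖deriv u x i + (c / x : ℝ) * u x i‖ ≤ ‖diracExpr k u x‖ := by
  fin_cases i
  · refine ⟨-k, abs_neg k, fun x => ?_⟩
    have h := PiLp.norm_apply_le (diracExpr k u x) 1
    rw [diracExpr_apply_one, norm_mul, norm_neg, Complex.norm_I, one_mul] at h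
    exact h
  · refine ⟨k, rfl, fun x => ?_⟩
    have h := PiLp.norm_apply_le (diracExpr k u x) 0
    rw [diracExpr_apply_zero, norm_mul, norm_neg, Complex.norm_I, one_mul] at h
    exact h

/-- Functions in the domain of the Dirac operator are bounded. -/
theorem IsRegularRep.norm_le {k : ℝ} (hk : 1 / 2 ≤ |k|) (ψ : (diracOp k).domain)
    {u : ℝ → Spinor} (hu : IsRegularRep k (ψ : L2Spinor) u) {x : ℝ} (hx : 0 < x) :
    ‖u x‖ ≤ 2 * ‖diracOp k ψ‖ + 4 * ‖(ψ : L2Spinor)‖ := by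
  set A := ‖diracOp k ψ‖ with hA
  set B := ‖(ψ : L2Spinor)‖ with hB
  -- The scalar bound is for real functions. Here `ℓ` is the real or imaginary part, which commutes
  -- with the real coefficient `c / x`.
  have hscalar : ∀ (ℓ : ℂ →L[ℝ] ℝ), (∀ z, |ℓ z| ≤ ‖z‖) → (∀ (r : ℝ) z, ℓ (r * z) = r * ℓ z) →
      ∀ i, ℓ (u x i) ^ 2 ≤ 2 * B ^ 2 + A ^ 2 := by
    intro ℓ hℓ hℓr i
    obtain ⟨c, hck, hc⟩ := norm_deriv_add_le_norm_diracExpr k u i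
    have hd : ∀ y, DifferentiableAt ℝ u y →
        HasDerivAt (fun t => ℓ (u t i)) (ℓ (deriv u y i)) y := fun y hy =>
      (ℓ.comp (coord i)).hasFDerivAt.comp_hasDerivAt y hy.hasDerivAt
    have h := sq_le_integral_of_half_le_abs (c := c) (v := fun t => ℓ (u t i))
      (N := fun t => ‖(ψ : L2Spinor) t‖) (G := fun t => ‖diracOp k ψ t‖) (by rwa [hck])
      (fun a b ha hab => (hu.locallyAC a b ha hab).clm_comp (ℓ.comp (coord i)))
      (by
        filter_upwards [hu.ae_eq] with t ht
        rw [ht]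
        exact (hℓ _).trans (PiLp.norm_apply_le _ _))
      (by
        filter_upwards [hu.locallyAC.ae_differentiableAt] with t ht
        exact (hd t ht).differentiableAt)
      (by
        filter_upwards [hu.locallyAC.ae_differentiableAt, diracOp_ae_eq ψ hu] with t ht ht'
        rw [(hd t ht).deriv, ht', ← hℓr, ← map_add]
        exact (hℓ _).trans (hc t))
      (integrable_norm_sq _) (integrable_norm_sq _) hx
    rwa [integral_norm_sq_eq_norm_sq, integral_norm_sq_eq_norm_sq] at h
  have hre := hscalar Complex.reCLM Complex.abs_re_le_norm (by simp)
  have him := hscalar Complex.imCLM Complex.abs_im_le_norm (by simp)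
  simp only [Complex.reCLM_apply, Complex.imCLM_apply] at hre him
  have hsum : ‖u x‖ ^ 2 ≤ 4 * (2 * B ^ 2 + A ^ 2) := by
    rw [EuclideanSpace.norm_sq_eq, Fin.sum_univ_two, Complex.sq_norm, Complex.sq_norm,
      Complex.normSq_apply, Complex.normSq_apply]
    linarith [hre 0, hre 1, him 0, him 1]
  have hA0 : 0 ≤ A := norm_nonneg _
  have hB0 : 0 ≤ B := norm_nonneg _
  refine abs_le_of_sq_le_sq' ?_ (by positivity) |>.2
  -- `4 (2 B² + A²) ≤ (2 A + 4 B)²`.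
  nlinarith [mul_nonneg hA0 hB0]

/-! ### Splitting off a small `L²` part -/

/-- A function in `Lᵖ` with `2 ≤ p ≤ ∞` is dominated by the sum of a function with small `L²` norm
and a constant. -/
theorem exists_memLp_two_add_const_of_memLp {α : Type*} [MeasurableSpace α] {μ : Measure α}
    {p : ℝ≥0∞} (hp : 2 ≤ p) {m : α → ℝ} (hm : MemLp m p μ) {δ : ℝ} (hδ : 0 < δ) :
    ∃ R : ℝ, 0 ≤ R ∧ ∃ n : α → ℝ, MemLp n 2 μ ∧ eLpNorm n 2 μ ≤ ENNReal.ofReal δ ∧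
      ∀ᵐ x ∂μ, |m x| ≤ |n x| + R := by
  rcases eq_or_ne p ∞ with rfl | hp'
  · refine ⟨(eLpNorm m ∞ μ).toReal, ENNReal.toReal_nonneg, 0, MemLp.zero, by simp, ?_⟩
    filter_upwards [enorm_ae_le_eLpNormEssSup m μ] with x hx
    have := ENNReal.toReal_mono hm.eLpNorm_lt_top.ne hx
    simpa using this
  · set f := hm.1.mk m with hf
    have hfm : StronglyMeasurable f := hm.1.stronglyMeasurable_mk
    have hfp : MemLp f p μ := (memLp_congr_ae hm.1.ae_eq_mk).1 hm
    have hs : MeasurableSet {x | (1 : NNReal) ≤ ‖f x‖₊} :=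
      measurableSet_le measurable_const hfm.nnnorm.measurable
    -- The set where `|f| ≥ 1` has finite measure, so there `Lᵖ` embeds into `L²`. The part of `f₁`
    -- above a high level `R` then has small `L²` norm, and what is left of `f` is at most `R + 1`.
    set f₁ := {x | (1 : NNReal) ≤ ‖f x‖₊}.indicator f with hf₁
    have h2 : MemLp f₁ 2 μ :=
      (hfp.indicator hs).mono_exponent_of_measure_support_ne_top
        (fun x hx => indicator_of_notMem hx _)
        (hfp.meas_ge_lt_top (by positivity) hp' one_ne_zero).ne hp
    have hf₁m : StronglyMeasurable f₁ := hfm.indicator hs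
    obtain ⟨R, hR, hle⟩ := h2.eLpNorm_indicator_norm_ge_pos_le hf₁m hδ
    have ht : MeasurableSet {x | R ≤ (‖f₁ x‖₊ : ℝ)} :=
      measurableSet_le measurable_const hf₁m.norm.measurable
    refine ⟨R + 1, by positivity, _, h2.indicator ht, hle, ?_⟩
    filter_upwards [hm.1.ae_eq_mk] with x hx
    rw [hx, ← hf]
    by_cases h1 : (1 : NNReal) ≤ ‖f x‖₊
    · have e1 : f₁ x = f x := indicator_of_mem (s := {x | (1 : NNReal) ≤ ‖f x‖₊}) h1 f
      by_cases h3 : R ≤ ‖f₁ x‖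
      · rw [indicator_of_mem (s := {x | R ≤ (‖f₁ x‖₊ : ℝ)}) h3, e1]
        linarith
      · rw [e1, not_le, Real.norm_eq_abs] at h3
        linarith [abs_nonneg ({x | R ≤ (‖f₁ x‖₊ : ℝ)}.indicator f₁ x)]
    · have h4 : ‖f x‖ < 1 := by exact_mod_cast not_le.1 h1
      rw [Real.norm_eq_abs] at h4
      linarith [abs_nonneg ({x | R ≤ (‖f₁ x‖₊ : ℝ)}.indicator f₁ x)]

/-! ### Relative bound for multiplication operators -/

theorem act_apply (m : Matrix (Fin 2) (Fin 2) ℂ) (w : Spinor) (i : Fin 2) :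
    act m w i = ∑ j, m i j * w j := by
  fin_cases i <;> simp [act, Matrix.toLpLin_apply]

theorem norm_act_le (m : Matrix (Fin 2) (Fin 2) ℂ) (w : Spinor) :
    ‖act m w‖ ≤ (∑ i, ∑ j, ‖m i j‖) * ‖w‖ := by
  have hsum : ‖act m w‖ ≤ ∑ i, ‖act m w i‖ := by
    refine abs_le_of_sq_le_sq' ?_ (by positivity) |>.2
    rw [EuclideanSpace.norm_sq_eq]
    exact Finset.sum_sq_le_sq_sum_of_nonneg fun i _ => norm_nonneg _
  refine hsum.trans ?_
  rw [Finset.sum_mul]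
  refine Finset.sum_le_sum fun i _ => ?_
  rw [act_apply, Finset.sum_mul]
  refine (norm_sum_le _ _).trans (Finset.sum_le_sum fun j _ => ?_)
  rw [norm_mul]
  exact mul_le_mul_of_nonneg_left (PiLp.norm_apply_le w j) (norm_nonneg _)

theorem aestronglyMeasurable_act {M : ℝ → Matrix (Fin 2) (Fin 2) ℂ} {μ : Measure ℝ}
    (hM : ∀ i j, AEStronglyMeasurable (fun x => M x i j) μ) {w : ℝ → Spinor}
    (hw : AEStronglyMeasurable w μ) : AEStronglyMeasurable (fun x => act (M x) (w x)) μ := by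
  have hcoord : ∀ i, AEMeasurable (fun x => act (M x) (w x) i) μ := fun i => by
    simp only [act_apply]
    refine Finset.aemeasurable_fun_sum _ fun j _ => (hM i j).aemeasurable.mul ?_
    exact (coord j).continuous.measurable.comp_aemeasurable hw.aemeasurable
  have h := (WithLp.measurable_toLp 2 (Fin 2 → ℂ)).comp_aemeasurable
    (aemeasurable_pi_lambda _ hcoord)
  exact h.aestronglyMeasurable

/-- Multiplication by a matrix-valued function in `Lᵖ`, `2 ≤ p ≤ ∞`, is infinitesimally bounded
with respect to `h_k`, `|k| ≥ 1/2`. -/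
theorem isInfinitesimallyBounded_mulOp_diracOp {k : ℝ} (hk : 1 / 2 ≤ |k|) {p : ℝ≥0∞} (hp : 2 ≤ p)
    {M : ℝ → Matrix (Fin 2) (Fin 2) ℂ} (hM : ∀ i j, MemLp (fun x => M x i j) p halfLine) :
    IsInfinitesimallyBounded (mulOp M) (diracOp k) := by
  have hm : MemLp (fun x => ∑ i, ∑ j, ‖M x i j‖) p halfLine :=
    memLp_finsetSum _ fun i _ => memLp_finsetSum _ fun j _ => (hM i j).norm
  -- Membership in `L²` and the norm estimate come from the same pointwise majorant `S |n| + R ‖ψ‖`,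
  -- where `S` is the sup bound.
  have key : ∀ δ : ℝ, 0 < δ → ∃ R : ℝ, 0 ≤ R ∧ ∀ ψ : (diracOp k).domain,
      MemLp (fun x => act (M x) ((ψ : L2Spinor) x)) 2 halfLine ∧
      eLpNorm (fun x => act (M x) ((ψ : L2Spinor) x)) 2 halfLine ≤ ENNReal.ofReal
        ((2 * ‖diracOp k ψ‖ + 4 * ‖(ψ : L2Spinor)‖) * δ + R * ‖(ψ : L2Spinor)‖) := by
    intro δ hδ
    obtain ⟨R, hR, n, hn, hnδ, hmn⟩ := exists_memLp_two_add_const_of_memLp hp hm hδ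
    refine ⟨R, hR, fun ψ => ?_⟩
    obtain ⟨u, hu⟩ := ψ.2
    set S := 2 * ‖diracOp k ψ‖ + 4 * ‖(ψ : L2Spinor)‖ with hS
    have hS0 : 0 ≤ S := by positivity
    have hmem1 : MemLp (S • fun x => ‖n x‖) 2 halfLine := hn.norm.const_smul S
    have hmem2 : MemLp (R • fun x => ‖(ψ : L2Spinor) x‖) 2 halfLine :=
      (Lp.memLp (ψ : L2Spinor)).norm.const_smul R
    have hle : ∀ᵐ x ∂halfLine, ‖act (M x) ((ψ : L2Spinor) x)‖ ≤
        ((S • fun x => ‖n x‖) + R • fun x => ‖(ψ : L2Spinor) x‖) x := by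
      filter_upwards [hmn, hu.ae_eq, ae_restrict_mem measurableSet_Ioi] with x h1 h2 h3
      have h4 : ‖(ψ : L2Spinor) x‖ ≤ S := by
        rw [h2]
        exact hu.norm_le hk ψ h3
      calc ‖act (M x) ((ψ : L2Spinor) x)‖
          ≤ (∑ i, ∑ j, ‖M x i j‖) * ‖(ψ : L2Spinor) x‖ := norm_act_le _ _
        _ ≤ (|n x| + R) * ‖(ψ : L2Spinor) x‖ :=
          mul_le_mul_of_nonneg_right ((le_abs_self _).trans h1) (norm_nonneg _)
        _ ≤ S * |n x| + R * ‖(ψ : L2Spinor) x‖ := by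
          nlinarith [mul_le_mul_of_nonneg_left h4 (abs_nonneg (n x))]
    refine ⟨(hmem1.add hmem2).mono' (aestronglyMeasurable_act (fun i j => (hM i j).1)
      (Lp.aestronglyMeasurable _)) hle, ?_⟩
    refine (eLpNorm_mono_ae_real hle).trans
      ((eLpNorm_add_le hmem1.1 hmem2.1 (by norm_num)).trans ?_)
    rw [eLpNorm_const_smul, eLpNorm_const_smul, eLpNorm_norm, eLpNorm_norm,
      ENNReal.ofReal_add (by positivity) (by positivity), ENNReal.ofReal_mul hS0,
      ENNReal.ofReal_mul hR, Real.enorm_of_nonneg hS0, Real.enorm_of_nonneg hR, Lp.norm_def,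
      ENNReal.ofReal_toReal (Lp.eLpNorm_ne_top _)]
    gcongr
  have hdom : (diracOp k).domain ≤ (mulOp M).domain := fun ψ hψ => by
    obtain ⟨R, -, h⟩ := key 1 one_pos
    exact (h ⟨ψ, hψ⟩).1
  refine ⟨hdom, fun ε hε => ?_⟩
  -- The factor `2` before `‖h_k ψ‖` in the sup bound forces `δ = ε / 2`; its factor `4` contributes
  -- `2 ε` to the constant.
  obtain ⟨R, hR, h⟩ := key (ε / 2) (by positivity)
  refine ⟨2 * ε + R, by positivity, fun ψ => ?_⟩
  calc ‖mulOp M ⟨ψ, hdom ψ.2⟩‖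
      = (eLpNorm (fun x => act (M x) ((ψ : L2Spinor) x)) 2 halfLine).toReal :=
        Lp.norm_toLp _ (h ψ).1
    _ ≤ (2 * ‖diracOp k ψ‖ + 4 * ‖(ψ : L2Spinor)‖) * (ε / 2) + R * ‖(ψ : L2Spinor)‖ :=
        ENNReal.toReal_le_of_le_ofReal (by positivity) (h ψ).2
    _ = ε * ‖diracOp k ψ‖ + (2 * ε + R) * ‖(ψ : L2Spinor)‖ := by ring

end RadialDirac

theorem theorem5p1 (k : ℝ) (hk : 1 / 2 ≤ |k|) :
    (∀ p : ℝ≥0∞, 2 < p → ∀ M : ℝ → Matrix (Fin 2) (Fin 2) ℂ,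
      (∀ i j, MemLp (fun x => M x i j) p RadialDirac.halfLine) →
        RadialDirac.IsInfinitesimallyBounded (RadialDirac.mulOp M) (RadialDirac.diracOp k)) ∧
    (1 / 2 < |k| → ∀ M : ℝ → Matrix (Fin 2) (Fin 2) ℂ,
      (∀ i j, MemLp (fun x => M x i j) 2 RadialDirac.halfLine) →
        RadialDirac.IsInfinitesimallyBounded (RadialDirac.mulOp M) (RadialDirac.diracOp k)) :=
  ⟨fun _ hp _ hM => RadialDirac.isInfinitesimallyBounded_mulOp_diracOp hk hp.le hM,
    fun _ _ hM => RadialDirac.isInfinitesimallyBounded_mulOp_diracOp hk le_rfl hM⟩
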